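/- Let $d\ge 2$, $b\in\{1,\dots,d-1\}$ and $a\in\mathbb{R}^d$ with $a_i<0$ for $i\le b$ and $a_i>0$ for $i>b$, and let $f_a(x)=\sum_{i=1}^d a_i x_i^2$ for $x \in \mathbb{R}^d$. Let $\alpha>1$, $m_0\in\mathbb{R}^d$ and $\sigma_0>0$. Let $(m_t,\sigma_t)_{t\in\mathbb{N}}$ be the sequence of states of the (1+1)-ES with $1/5$-success rule on $f_a$ started in $(m_0,\sigma_0)$: for $t=0,1,2,\dots$, given the past, an offspring $x_t\sim\mathcal{N}(m_t,\sigma_t^2 I)$ is sampled; if $f_a(x_t)\le f_a(m_t)$ then $m_{t+1}=x_t$ and $\sigma_{t+1}=\sigma_t\cdot\alpha$; otherwise $m_{t+1}=m_t$ and $\sigma_{t+1}=\sigma_t\cdot\alpha^{-1/4}$. Then, almost surely, there exists $T\in\mathbb{N}$ such that $f_a(m_t)<0$ for all $t\ge T$. In particular, almost surely, the saddle point $0$ of $f_a$ is not a limit point (i.e. not the limit of any subsequence) of the sequence $(m_t)_{t\in\mathbb{N}}$. -/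

import Mathlib

open MeasureTheory ProbabilityTheory Filter Topology

/-- The quadratic function `f_a(x) = ∑ i, a i * x i ^ 2` on `ℝ^d`. -/
def quadSaddle {d : ℕ} (a : Fin d → ℝ) (x : EuclideanSpace ℝ (Fin d)) : ℝ :=
  ∑ i, a i * x i ^ 2

/-- `IsOnePlusOneES f α m₀ σ₀ μ ℱ m σ x`: on the probability space with law `μ` and filtration `ℱ`,
the means `m t`, step sizes `σ t` and offspring `x t` form a run of the (1+1)-ES with 1/5-success
rule on the objective function `f`, with step size parameter `α` and initial state `(m₀, σ₀)`.
The `σ`-algebra `ℱ t` is the information available before the offspring of iteration `t` is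
sampled. -/
structure IsOnePlusOneES {d : ℕ} (f : EuclideanSpace ℝ (Fin d) → ℝ) (α : ℝ)
    (m₀ : EuclideanSpace ℝ (Fin d)) (σ₀ : ℝ)
    {Ω : Type*} [MeasurableSpace Ω] (μ : Measure Ω) (ℱ : Filtration ℕ ‹MeasurableSpace Ω›)
    (m : ℕ → Ω → EuclideanSpace ℝ (Fin d)) (σ : ℕ → Ω → ℝ)
    (x : ℕ → Ω → EuclideanSpace ℝ (Fin d)) : Prop where
  /-- the initial mean -/
  mean_zero : ∀ ω, m 0 ω = m₀
  /-- the initial step size -/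
  step_zero : ∀ ω, σ 0 ω = σ₀
  /-- the offspring of iteration `t` is known after iteration `t` -/
  measurable_offspring : ∀ t, Measurable[ℱ (t + 1)] (x t)
  /-- given the past, the offspring is sampled from the normal distribution `N(m_t, σ_t² I)` -/
  sample : ∀ t, ∀ A : Set (EuclideanSpace ℝ (Fin d)), MeasurableSet A →
    μ⟦x t ⁻¹' A | ℱ t⟧ =ᵐ[μ] fun ω =>
      (multivariateGaussian (m t ω) (σ t ω ^ 2 • (1 : Matrix (Fin d) (Fin d) ℝ))).real A
  /-- success: move to the offspring and increase the step size -/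
  success : ∀ t ω, f (x t ω) ≤ f (m t ω) →
    m (t + 1) ω = x t ω ∧ σ (t + 1) ω = σ t ω * α
  /-- failure: keep the mean and decrease the step size -/
  failure : ∀ t ω, ¬ f (x t ω) ≤ f (m t ω) →
    m (t + 1) ω = m t ω ∧ σ (t + 1) ω = σ t ω * α ^ (-(1 / 4) : ℝ)

/-!
The objective never increases along a run of the (1+1)-ES, so it suffices to show that it almost
surely becomes negative at some time. This follows from a geometric drift of the potential
`V (m, σ) = (‖m‖ / σ) ^ s + A` on states with `f m ≥ 0`, and `V (m, σ) = 0` on states with `f m < 0`,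
for a small exponent `s` and a large constant `A`: in every iteration the expectation of `V` shrinks
at least by a fixed factor `ρ < 1`, so the probability of `f (m t) ≥ 0`, being at most
`E V (m t, σ t) / A`, tends to zero.

The drift has two sources, depending on the ratio `‖m‖ / σ`.

* If the ratio is large, the linear part of `z ↦ f (m + σ z)` dominates, because the quadratic form
  is nondegenerate. The success probability is then at least `1 / 4`
  (`exists_le_stdGaussian_success`), which exceeds the target rate `1 / 5`, and `σ ^ (-s)` contracts
  in expectation (`exists_rpow_contraction`). As `s ≤ 1`, the motion of `m` contributes only the
  additive constant `1 + E ‖z‖`.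
* If the ratio is bounded, the offspring has a negative function value with probability at least
  some `p > 0`, since `f` has a direction of negative curvature (`exists_le_stdGaussian_neg`). The
  summand `A` is then lost with probability at least `p`.

`exists_potential_drift` combines the two cases, and `IsOnePlusOneES.map_state_offspring` turns the
conditional sampling hypothesis into the joint law of a state and its offspring, through which the
one-step estimate passes to the process (`IsOnePlusOneES.ae_exists_neg`).
-/

/-! ### The standard Gaussian measure -/

lemma isOpenPosMeasure_stdGaussian (ι : Type*) [Fintype ι] :
    (stdGaussian (EuclideanSpace ℝ ι)).IsOpenPosMeasure := by
  have : (gaussianReal 0 1).IsOpenPosMeasure :=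
    (gaussianReal_absolutelyContinuous' 0 one_ne_zero).isOpenPosMeasure
  rw [← map_pi_eq_stdGaussian]
  exact (PiLp.continuous_toLp 2 _).isOpenPosMeasure_map (WithLp.toLp_surjective 2)

open scoped MatrixOrder in
lemma multivariateGaussian_sq_smul_one {d : ℕ} (m : EuclideanSpace ℝ (Fin d)) {σ : ℝ}
    (hσ : 0 ≤ σ) :
    multivariateGaussian m (σ ^ 2 • (1 : Matrix (Fin d) (Fin d) ℝ)) =
      (stdGaussian (EuclideanSpace ℝ (Fin d))).map (fun z => m + σ • z) := by
  have h0 : (0 : Matrix (Fin d) (Fin d) ℝ) ≤ σ • 1 :=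
    Matrix.nonneg_iff_posSemidef.2 (Matrix.PosSemidef.one.smul hσ)
  have h : CFC.sqrt (σ ^ 2 • (1 : Matrix (Fin d) (Fin d) ℝ)) = σ • 1 := by
    rw [show σ ^ 2 • (1 : Matrix (Fin d) (Fin d) ℝ) = (σ • 1) * (σ • 1) by
      simp [smul_smul, pow_two], CFC.sqrt_mul_self _ h0]
  simp [multivariateGaussian, h]

section
variable {E : Type*} [NormedAddCommGroup E] [InnerProductSpace ℝ E] [FiniteDimensional ℝ E]
  [MeasurableSpace E] [BorelSpace E]

lemma map_inner_stdGaussian {u : E} (hu : ‖u‖ = 1) :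
    (stdGaussian E).map (fun z => inner ℝ u z) = gaussianReal 0 1 := by
  have h := IsGaussian.map_eq_gaussianReal (μ := stdGaussian E) (innerSL ℝ u)
  rw [variance_dual_stdGaussian, integral_strongDual_stdGaussian, innerSL_apply_norm, hu] at h
  simpa [innerSL_apply_apply] using! h

lemma gaussianReal_real_Iio_zero : (gaussianReal 0 1).real (Set.Iio 0) = 1 / 2 := by
  have : NullSingletonClass (gaussianReal 0 1) := nullSingletonClass_gaussianReal one_ne_zero
  have hneg : (gaussianReal 0 1).real (Set.Ioi 0) = (gaussianReal 0 1).real (Set.Iio 0) := by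
    have h := gaussianReal_map_neg (μ := 0) (v := 1)
    rw [neg_zero] at h
    conv_lhs => rw [← h]
    rw [map_measureReal_apply measurable_neg measurableSet_Ioi]
    simp
  have hc := probReal_compl_eq_one_sub (μ := gaussianReal 0 1) (s := Set.Iio 0) measurableSet_Iio
  rw [Set.compl_Iio, ← measureReal_congr (Ioi_ae_eq_Ici (μ := gaussianReal 0 1) (a := 0)),
    hneg] at hc
  linarith

/-- By rotational invariance, `η` is uniform over all directions `u`. -/
lemma exists_le_stdGaussian_inner_le_neg :
    ∃ η > 0, ∀ u : E, ‖u‖ = 1 → 3 / 8 ≤ (stdGaussian E).real {z | inner ℝ u z ≤ -η} := by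
  -- the half-lines `Iic (-1 / (n + 1))` exhaust `Iio 0`, which has mass `1 / 2`
  have hmono : Monotone fun n : ℕ => Set.Iic (-(1 / ((n : ℝ) + 1))) := fun i j hij =>
    Set.Iic_subset_Iic.2 (neg_le_neg (one_div_le_one_div_of_le (by positivity) (by gcongr)))
  have hU : ⋃ n : ℕ, Set.Iic (-(1 / ((n : ℝ) + 1))) = Set.Iio 0 := by
    ext y
    simp only [Set.mem_iUnion, Set.mem_Iic, Set.mem_Iio]
    constructor
    · rintro ⟨n, hn⟩
      have : (0 : ℝ) < 1 / ((n : ℝ) + 1) := by positivity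
      linarith
    · intro hy
      obtain ⟨n, hn⟩ := exists_nat_one_div_lt (neg_pos.2 hy)
      exact ⟨n, by linarith⟩
  have ht := tendsto_measure_iUnion_atTop (μ := gaussianReal 0 1) hmono
  rw [hU] at ht
  have ht' := (ENNReal.tendsto_toReal (measure_ne_top _ _)).comp ht
  have h2 : (gaussianReal 0 1 (Set.Iio 0)).toReal = 1 / 2 := gaussianReal_real_Iio_zero
  rw [h2] at ht'
  obtain ⟨n, hn⟩ := (ht'.eventually (lt_mem_nhds (show (3 / 8 : ℝ) < 1 / 2 by norm_num))).exists
  refine ⟨1 / ((n : ℝ) + 1), by positivity, fun u hu => ?_⟩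
  have h := map_measureReal_apply (μ := stdGaussian E) (f := fun z => inner ℝ u z)
    (by fun_prop) (measurableSet_Iic (a := -(1 / ((n : ℝ) + 1))))
  rw [map_inner_stdGaussian hu] at h
  exact hn.le.trans h.le

variable (E) in
lemma integrable_norm_stdGaussian : Integrable (fun z => ‖z‖) (stdGaussian E) :=
  IsGaussian.integrable_fun_id.norm

variable (E) in
lemma exists_stdGaussian_le_norm_le :
    ∃ M > 0, (stdGaussian E).real {z | M ≤ ‖z‖} ≤ 1 / 8 := by
  have h0 : 0 ≤ ∫ z, ‖z‖ ∂(stdGaussian E) := integral_nonneg fun _ => norm_nonneg _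
  refine ⟨8 * (∫ z, ‖z‖ ∂(stdGaussian E)) + 1, by linarith, ?_⟩
  have h := mul_meas_ge_le_integral_of_nonneg (Eventually.of_forall fun z => norm_nonneg z)
    (integrable_norm_stdGaussian E) (8 * (∫ z, ‖z‖ ∂(stdGaussian E)) + 1)
  set P := (stdGaussian E).real {z | 8 * (∫ z, ‖z‖ ∂(stdGaussian E)) + 1 ≤ ‖z‖}
  have hP : 0 ≤ P := measureReal_nonneg
  by_contra! hlt
  nlinarith
end

/-! ### Success probabilities of a Gaussian step on a quadratic form -/

section
variable {d : ℕ} (a : Fin d → ℝ)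

@[fun_prop]
lemma continuous_quadSaddle : Continuous (quadSaddle a) := by
  unfold quadSaddle; fun_prop

lemma quadSaddle_smul (c : ℝ) (v : EuclideanSpace ℝ (Fin d)) :
    quadSaddle a (c • v) = c ^ 2 * quadSaddle a v := by
  simp only [quadSaddle, Finset.mul_sum, PiLp.smul_apply, smul_eq_mul]
  exact Finset.sum_congr rfl fun i _ => by ring

/-- The exact second-order expansion at `m`, with half the gradient `(a i * m i)ᵢ` in the linear
term. -/
lemma quadSaddle_add_smul (m z : EuclideanSpace ℝ (Fin d)) (σ : ℝ) :
    quadSaddle a (m + σ • z) = quadSaddle a m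
      + 2 * σ * inner ℝ (WithLp.toLp 2 fun i => a i * m i : EuclideanSpace ℝ (Fin d)) z
      + σ ^ 2 * quadSaddle a z := by
  simp only [quadSaddle, PiLp.inner_apply, Finset.mul_sum, ← Finset.sum_add_distrib,
    PiLp.add_apply, PiLp.smul_apply, smul_eq_mul]
  refine Finset.sum_congr rfl fun i _ => ?_
  simp
  ring

lemma abs_quadSaddle_le (v : EuclideanSpace ℝ (Fin d)) :
    |quadSaddle a v| ≤ (∑ i, |a i|) * ‖v‖ ^ 2 := by
  rw [quadSaddle, Finset.sum_mul]
  refine (Finset.abs_sum_le_sum_abs _ _).trans (Finset.sum_le_sum fun i _ => ?_)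
  rw [abs_mul, abs_pow]
  gcongr
  exact PiLp.norm_apply_le v i

variable {a}

lemma exists_mul_norm_le_norm_gradient (ha : ∀ i, a i ≠ 0) :
    ∃ c > 0, ∀ m : EuclideanSpace ℝ (Fin d),
      c * ‖m‖ ≤ ‖(WithLp.toLp 2 fun i => a i * m i : EuclideanSpace ℝ (Fin d))‖ := by
  obtain ⟨c, hc, hca⟩ : ∃ c > 0, ∀ i, c ≤ |a i| := by
    rcases isEmpty_or_nonempty (Fin d) with h | h
    · exact ⟨1, one_pos, fun i => h.elim i⟩
    · obtain ⟨j, hj⟩ := Finite.exists_min fun i => |a i|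
      exact ⟨|a j|, abs_pos.2 (ha j), hj⟩
  refine ⟨c, hc, fun m => ?_⟩
  refine (sq_le_sq₀ (by positivity) (norm_nonneg _)).1 ?_
  rw [mul_pow, EuclideanSpace.real_norm_sq_eq, EuclideanSpace.real_norm_sq_eq, Finset.mul_sum]
  refine Finset.sum_le_sum fun i _ => ?_
  simp only [mul_pow]
  gcongr ?_ * _
  rw [← sq_abs (a i)]
  gcongr
  exact hca i

/-- Where the step size is small compared with the distance to the saddle point, the linear term
of the objective dominates and a Gaussian step is successful with probability close to `1 / 2`. -/
lemma exists_le_stdGaussian_success (ha : ∀ i, a i ≠ 0) :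
    ∃ K > 0, ∀ (m : EuclideanSpace ℝ (Fin d)) (σ : ℝ), 0 < σ → K * σ ≤ ‖m‖ →
      1 / 4 ≤ (stdGaussian (EuclideanSpace ℝ (Fin d))).real
        {z | quadSaddle a (m + σ • z) ≤ quadSaddle a m} := by
  obtain ⟨c, hc, hcm⟩ := exists_mul_norm_le_norm_gradient ha
  obtain ⟨η, hη, hηu⟩ := exists_le_stdGaussian_inner_le_neg (E := EuclideanSpace ℝ (Fin d))
  obtain ⟨M, hM, hMP⟩ := exists_stdGaussian_le_norm_le (EuclideanSpace ℝ (Fin d))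
  set C := ∑ i, |a i| with hCdef
  have hC : 0 ≤ C := Finset.sum_nonneg fun i _ => abs_nonneg _
  refine ⟨C * M ^ 2 / (2 * η * c) + 1, by positivity, fun m σ hσ hm => ?_⟩
  set g : EuclideanSpace ℝ (Fin d) := WithLp.toLp 2 fun i => a i * m i with hg
  have hm0 : 0 < ‖m‖ := lt_of_lt_of_le (by positivity) hm
  have hg0 : 0 < ‖g‖ := lt_of_lt_of_le (by positivity) (hcm m)
  have hK : C * M ^ 2 * σ ≤ 2 * η * ‖g‖ := by
    have h1 : C * M ^ 2 / (2 * η * c) * σ ≤ ‖m‖ := le_trans (by nlinarith) hm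
    rw [div_mul_eq_mul_div, div_le_iff₀ (by positivity)] at h1
    have := mul_le_mul_of_nonneg_left (hcm m) (show 0 ≤ 2 * η by positivity)
    linarith
  have hu : ‖(‖g‖⁻¹ • g : EuclideanSpace ℝ (Fin d))‖ = 1 := by
    rw [norm_smul, norm_inv, norm_norm, inv_mul_cancel₀ hg0.ne']
  have hsub : {z : EuclideanSpace ℝ (Fin d) | inner ℝ (‖g‖⁻¹ • g) z ≤ -η} ⊆
      {z | quadSaddle a (m + σ • z) ≤ quadSaddle a m} ∪ {z | M ≤ ‖z‖} := by
    intro z hz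
    by_cases hzM : M ≤ ‖z‖
    · exact Or.inr hzM
    left
    push Not at hzM
    simp only [Set.mem_ofPred_eq] at hz ⊢
    rw [real_inner_smul_left, inv_mul_le_iff₀ hg0] at hz
    rw [quadSaddle_add_smul, ← hg]
    have h1 : quadSaddle a z ≤ C * M ^ 2 := by
      refine (le_abs_self _).trans ((abs_quadSaddle_le a z).trans ?_)
      gcongr
    have h2 : σ * (σ * quadSaddle a z) ≤ σ * (2 * η * ‖g‖) :=
      mul_le_mul_of_nonneg_left (by nlinarith) hσ.le
    have h3 := mul_le_mul_of_nonneg_left hz hσ.le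
    nlinarith
  have h1 := measureReal_mono (μ := stdGaussian (EuclideanSpace ℝ (Fin d))) hsub
  have h2 := measureReal_union_le (μ := stdGaussian (EuclideanSpace ℝ (Fin d)))
    {z | quadSaddle a (m + σ • z) ≤ quadSaddle a m} {z | M ≤ ‖z‖}
  linarith [hηu _ hu]

/-- Where the step size is not small compared with the distance to the saddle point, a Gaussian
step reaches a negative function value with probability bounded away from zero. -/
lemma exists_le_stdGaussian_neg {j : Fin d} (hj : a j < 0) {K : ℝ} (hK : 0 < K) :
    ∃ p > 0, ∀ (m : EuclideanSpace ℝ (Fin d)) (σ : ℝ), 0 < σ → ‖m‖ ≤ K * σ →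
      p ≤ (stdGaussian (EuclideanSpace ℝ (Fin d))).real {z | quadSaddle a (m + σ • z) < 0} := by
  set C := ∑ i, |a i| with hCdef
  have hC : 0 ≤ C := Finset.sum_nonneg fun i _ => abs_nonneg _
  set R := K + 1 with hR
  set L := 2 * R + C * R ^ 2 / (-a j) + 1 with hL
  set e : EuclideanSpace ℝ (Fin d) := EuclideanSpace.single j 1 with he
  have hfe : quadSaddle a e = a j := by
    rw [quadSaddle, Finset.sum_eq_single j] <;> simp +contextual [he]
  have := isOpenPosMeasure_stdGaussian (Fin d)
  refine ⟨(stdGaussian (EuclideanSpace ℝ (Fin d))).real (Metric.ball (L • e) 1),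
    ENNReal.toReal_pos (Metric.measure_ball_pos _ _ one_pos).ne' (measure_ne_top _ _),
    fun m σ hσ hm => measureReal_mono fun z hz => ?_⟩
  set v := σ⁻¹ • m + (z - L • e) with hv
  have hvR : ‖v‖ ≤ R := by
    refine (norm_add_le _ _).trans (add_le_add ?_ ?_)
    · rw [norm_smul, norm_inv, Real.norm_of_nonneg hσ.le, inv_mul_le_iff₀ hσ]
      linarith
    · rw [← dist_eq_norm]
      exact (Metric.mem_ball.1 hz).le
  have hmv : m + σ • z = σ • (v + L • e) := by
    rw [hv, smul_add, smul_add, smul_sub, smul_smul, mul_inv_cancel₀ hσ.ne', one_smul]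
    abel
  rw [Set.mem_ofPred_eq, hmv, quadSaddle_smul]
  refine mul_neg_of_pos_of_neg (by positivity) ?_
  rw [quadSaddle_add_smul, hfe]
  have hin : inner ℝ (WithLp.toLp 2 fun i => a i * v i : EuclideanSpace ℝ (Fin d)) e
      = a j * v j := by
    simp [he, EuclideanSpace.inner_single_right]
  rw [hin]
  have h1 : quadSaddle a v ≤ C * R ^ 2 :=
    (le_abs_self _).trans ((abs_quadSaddle_le a v).trans (by gcongr))
  have h2 : |v j| ≤ R := (PiLp.norm_apply_le v j).trans hvR
  have hRpos : 0 < R := by positivity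
  have hq : 0 ≤ C * R ^ 2 / (-a j) := div_nonneg (by positivity) (by linarith)
  have hL1 : 1 ≤ L := by linarith
  have hLR : -a j * (L - 2 * R) = C * R ^ 2 + -a j := by
    have := mul_div_cancel₀ (C * R ^ 2) (neg_pos.2 hj).ne'
    linear_combination this
  have h3 : a j * v j ≤ -a j * R := by nlinarith [abs_le.1 h2]
  have h4 : L * (a j * v j) ≤ L * (-a j * R) := by gcongr
  have h5 : L * (-a j * (L - 2 * R)) ≥ C * R ^ 2 + -a j := by
    rw [hLR]
    nlinarith [mul_nonneg hC (sq_nonneg R)]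
  nlinarith
end

/-! ### Drift of the potential -/

/-- The deterministic state transition of the (1+1)-ES: the state `(m, σ)` after the offspring `x`
has been evaluated. -/
noncomputable def esNext {d : ℕ} (f : EuclideanSpace ℝ (Fin d) → ℝ) (α : ℝ)
    (p : EuclideanSpace ℝ (Fin d) × ℝ) (x : EuclideanSpace ℝ (Fin d)) :
    EuclideanSpace ℝ (Fin d) × ℝ :=
  if f x ≤ f p.1 then (x, p.2 * α) else (p.1, p.2 * α ^ (-(1 / 4) : ℝ))

/-- The potential `(‖m‖ / σ) ^ s + A` of a state `(m, σ)`, set to zero once the mean has reached a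
negative function value. -/
noncomputable def potential {d : ℕ} (a : Fin d → ℝ) (s A : ℝ)
    (p : EuclideanSpace ℝ (Fin d) × ℝ) : ENNReal :=
  if 0 ≤ quadSaddle a p.1 then ENNReal.ofReal ((‖p.1‖ / p.2) ^ s + A) else 0

/-- With a success probability of at least `1 / 4`, a small power of the inverse step size
contracts in expectation: `u` and `v` are the factors for success and failure. -/
lemma exists_rpow_contraction {α : ℝ} (hα : 1 < α) :
    ∃ s u v : ℝ, 0 < s ∧ s ≤ 1 ∧ α⁻¹ ^ s = u ∧ (α ^ (-(1 / 4) : ℝ))⁻¹ ^ s = v ∧ 0 < u ∧ u ≤ 1 ∧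
      1 ≤ v ∧ u / 4 + 3 * v / 4 < 1 := by
  have hα0 : 0 < α := one_pos.trans hα
  have hlog : 0 < Real.log α := Real.log_pos hα
  have hlog' : 0 < Real.log (11 / 10) := Real.log_pos (by norm_num)
  set s := min 1 (4 * Real.log (11 / 10) / Real.log α) with hs
  have hs0 : 0 < s := lt_min one_pos (by positivity)
  have hv1 : 1 < α ^ (s / 4) := Real.one_lt_rpow hα (by positivity)
  have hv2 : α ^ (s / 4) ≤ 11 / 10 := by
    rw [Real.rpow_def_of_pos hα0, ← Real.le_log_iff_exp_le (by norm_num)]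
    have h : s ≤ 4 * Real.log (11 / 10) / Real.log α := min_le_right _ _
    rw [le_div_iff₀ hlog] at h
    linarith
  have hu : α⁻¹ ^ s = ((α ^ (s / 4)) ^ 4)⁻¹ := by
    rw [← Real.rpow_natCast, ← Real.rpow_mul hα0.le, Real.inv_rpow hα0.le]
    congr 2
    push_cast
    ring
  have hv : (α ^ (-(1 / 4) : ℝ))⁻¹ ^ s = α ^ (s / 4) := by
    rw [← Real.rpow_neg hα0.le, ← Real.rpow_mul hα0.le]
    congr 1
    ring
  refine ⟨s, _, _, hs0, min_le_left _ _, rfl, rfl, by positivity, ?_, ?_, ?_⟩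
  · exact Real.rpow_le_one (by positivity) (inv_le_one_of_one_le₀ hα.le) hs0.le
  · exact hv ▸ hv1.le
  · rw [hu, hv]
    generalize α ^ (s / 4) = w at hv1 hv2
    -- `3 w ^ 5 - 4 w ^ 4 + 1` vanishes at `1` and is negative up to `11 / 10`
    obtain ⟨e, rfl⟩ : ∃ e, w = 1 + e := ⟨w - 1, by ring⟩
    have he : 0 < e := by linarith
    have he' : e ≤ 1 / 10 := by linarith
    have h4 : 0 < (1 + e) ^ 4 := by positivity
    have h2 : e ^ 2 ≤ (1 / 10) ^ 2 := by gcongr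
    have h3 : e ^ 3 ≤ (1 / 10) ^ 3 := by gcongr
    have h5 : e ^ 4 ≤ (1 / 10) ^ 4 := by gcongr
    have hneg : e * (-1 + 6 * e + 14 * e ^ 2 + 11 * e ^ 3 + 3 * e ^ 4) < 0 :=
      mul_neg_of_pos_of_neg he (by linarith)
    have hpoly : 1 + 3 * (1 + e) * (1 + e) ^ 4 < 4 * (1 + e) ^ 4 := by
      linear_combination hneg
    have h6 : (1 + 3 * (1 + e) * (1 + e) ^ 4) / (1 + e) ^ 4 < 4 := by
      rwa [div_lt_iff₀ h4]
    rw [add_div, mul_div_cancel_right₀ _ h4.ne', one_div] at h6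
    linarith

section
variable {d : ℕ} {a : Fin d → ℝ}

lemma measurable_esNext {f : EuclideanSpace ℝ (Fin d) → ℝ} (hf : Measurable f) (α : ℝ) :
    Measurable fun q : (EuclideanSpace ℝ (Fin d) × ℝ) × EuclideanSpace ℝ (Fin d) =>
      esNext f α q.1 q.2 :=
  Measurable.ite (measurableSet_le (by fun_prop) (by fun_prop)) (by fun_prop) (by fun_prop)

lemma measurable_potential (a : Fin d → ℝ) (s A : ℝ) : Measurable (potential a s A) :=
  Measurable.ite (measurableSet_le measurable_const
    ((continuous_quadSaddle a).measurable.comp measurable_fst)) (by fun_prop) measurable_const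

/-- Pointwise bound on the potential after one iteration; `u` and `v` are the factors by which
`σ ^ (-s)` changes upon success and failure. -/
lemma potential_esNext_le {α s u v A : ℝ} (hα : 1 < α) (hs : 0 < s) (hs1 : s ≤ 1)
    (hu : α⁻¹ ^ s = u) (hv : (α ^ (-(1 / 4) : ℝ))⁻¹ ^ s = v) (hu1 : u ≤ 1)
    {m : EuclideanSpace ℝ (Fin d)} {σ : ℝ} (hσ : 0 < σ) (hm : 0 ≤ quadSaddle a m)
    (z : EuclideanSpace ℝ (Fin d)) :
    potential a s A (esNext (quadSaddle a) α (m, σ) (m + σ • z)) ≤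
      ENNReal.ofReal (v * (‖m‖ / σ) ^ s
        - (v - u) * (‖m‖ / σ) ^ s *
          {z | quadSaddle a (m + σ • z) ≤ quadSaddle a m}.indicator 1 z
        + (1 + ‖z‖) + A * (1 - {z | quadSaddle a (m + σ • z) < 0}.indicator 1 z)) := by
  have hα0 : 0 < α := one_pos.trans hα
  have hu0 : 0 ≤ u := hu ▸ Real.rpow_nonneg (by positivity) _
  by_cases hS : quadSaddle a (m + σ • z) ≤ quadSaddle a m
  · by_cases hN : quadSaddle a (m + σ • z) < 0
    · simp [potential, esNext, hS, hN.not_ge]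
    · have hstep : ‖m + σ • z‖ / (σ * α) ≤ (‖m‖ / σ + ‖z‖) * α⁻¹ := by
        rw [div_mul_eq_div_div, ← div_eq_mul_inv]
        gcongr
        rw [div_le_iff₀ hσ, add_mul, div_mul_cancel₀ _ hσ.ne']
        refine (norm_add_le _ _).trans ?_
        rw [norm_smul, Real.norm_of_nonneg hσ.le, mul_comm σ]
      have hz : ‖z‖ ^ s ≤ 1 + ‖z‖ := by
        calc ‖z‖ ^ s ≤ (1 + ‖z‖) ^ s := by gcongr; linarith
          _ ≤ (1 + ‖z‖) ^ (1 : ℝ) :=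
            Real.rpow_le_rpow_of_exponent_le (by linarith [norm_nonneg z]) hs1
          _ = 1 + ‖z‖ := Real.rpow_one _
      have hpow : (‖m + σ • z‖ / (σ * α)) ^ s ≤ u * (‖m‖ / σ) ^ s + (1 + ‖z‖) := by
        calc (‖m + σ • z‖ / (σ * α)) ^ s ≤ ((‖m‖ / σ + ‖z‖) * α⁻¹) ^ s := by gcongr
          _ = u * (‖m‖ / σ + ‖z‖) ^ s := by
            rw [Real.mul_rpow (by positivity) (by positivity), hu, mul_comm]
          _ ≤ u * ((‖m‖ / σ) ^ s + ‖z‖ ^ s) := by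
            gcongr
            exact Real.rpow_add_le_add_rpow (by positivity) (norm_nonneg _) hs.le hs1
          _ ≤ u * (‖m‖ / σ) ^ s + (1 + ‖z‖) := by
            rw [mul_add]
            gcongr
            exact (mul_le_of_le_one_left (by positivity) hu1).trans hz
      simp only [potential, esNext, hS, if_true, not_lt.1 hN]
      refine ENNReal.ofReal_le_ofReal ?_
      simp only [Set.indicator, Set.mem_ofPred_eq, hS, hN, if_true, if_false, Pi.one_apply]
      linarith
  · have hN : ¬ quadSaddle a (m + σ • z) < 0 := fun h => hS (h.le.trans hm)
    simp only [potential, esNext, hS, if_false, hm, if_true]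
    refine ENNReal.ofReal_le_ofReal ?_
    simp only [Set.indicator, Set.mem_ofPred_eq, hS, hN, if_false]
    rw [div_mul_eq_div_div, div_eq_mul_inv (‖m‖ / σ), Real.mul_rpow (by positivity)
      (by positivity), hv]
    linarith [norm_nonneg z]

lemma lintegral_potential_esNext_le {α s u v A : ℝ} (hα : 1 < α) (hs : 0 < s) (hs1 : s ≤ 1)
    (hu : α⁻¹ ^ s = u) (hv : (α ^ (-(1 / 4) : ℝ))⁻¹ ^ s = v) (hu1 : u ≤ 1) (hv1 : 1 ≤ v)
    (hA : 0 ≤ A) {m : EuclideanSpace ℝ (Fin d)} {σ : ℝ} (hσ : 0 < σ) (hm : 0 ≤ quadSaddle a m) :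
    ∫⁻ z, potential a s A (esNext (quadSaddle a) α (m, σ) (m + σ • z))
        ∂stdGaussian (EuclideanSpace ℝ (Fin d)) ≤
      ENNReal.ofReal (v * (‖m‖ / σ) ^ s
        - (v - u) * (‖m‖ / σ) ^ s * (stdGaussian (EuclideanSpace ℝ (Fin d))).real
          {z | quadSaddle a (m + σ • z) ≤ quadSaddle a m}
        + (1 + ∫ z, ‖z‖ ∂stdGaussian (EuclideanSpace ℝ (Fin d)))
        + A * (1 - (stdGaussian (EuclideanSpace ℝ (Fin d))).real
          {z | quadSaddle a (m + σ • z) < 0})) := by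
  set γ := stdGaussian (EuclideanSpace ℝ (Fin d)) with hγ
  set S := {z : EuclideanSpace ℝ (Fin d) | quadSaddle a (m + σ • z) ≤ quadSaddle a m} with hS
  set N := {z : EuclideanSpace ℝ (Fin d) | quadSaddle a (m + σ • z) < 0} with hN
  have hSm : MeasurableSet S :=
    (isClosed_le (by fun_prop) continuous_const).measurableSet
  have hNm : MeasurableSet N := (isOpen_lt (by fun_prop) continuous_const).measurableSet
  have hu0 : 0 ≤ u := hu ▸ Real.rpow_nonneg (by positivity) _
  have hr : 0 ≤ (‖m‖ / σ) ^ s := by positivity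
  set r := (‖m‖ / σ) ^ s
  have hI : Integrable (fun z => ‖z‖) γ := integrable_norm_stdGaussian _
  have hIS : Integrable (S.indicator (1 : EuclideanSpace ℝ (Fin d) → ℝ)) γ :=
    (integrable_const (1 : ℝ)).indicator hSm
  have hIN : Integrable (N.indicator (1 : EuclideanSpace ℝ (Fin d) → ℝ)) γ :=
    (integrable_const (1 : ℝ)).indicator hNm
  have hI1 : Integrable (fun z => v * r - (v - u) * r * S.indicator 1 z) γ :=
    (integrable_const _).sub (hIS.const_mul _)
  have hI2 : Integrable (fun z => 1 + ‖z‖) γ := (integrable_const _).add hI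
  have hI3 : Integrable (fun z => A * (1 - N.indicator 1 z)) γ :=
    ((integrable_const _).sub hIN).const_mul _
  have hI12 : Integrable (fun z => v * r - (v - u) * r * S.indicator 1 z + (1 + ‖z‖)) γ :=
    hI1.add hI2
  have hI123 : Integrable (fun z => v * r - (v - u) * r * S.indicator 1 z + (1 + ‖z‖)
      + A * (1 - N.indicator 1 z)) γ := hI12.add hI3
  have hint : ∫ z, (v * r - (v - u) * r * S.indicator 1 z + (1 + ‖z‖)
      + A * (1 - N.indicator 1 z)) ∂γ =
      v * r - (v - u) * r * γ.real S + (1 + ∫ z, ‖z‖ ∂γ) + A * (1 - γ.real N) := by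
    rw [integral_add hI12 hI3, integral_add hI1 hI2,
      integral_sub (integrable_const _) (hIS.const_mul _), integral_add (integrable_const _) hI,
      integral_const_mul _ (S.indicator _), integral_const_mul A, integral_sub (integrable_const _) hIN,
      integral_indicator_one hSm, integral_indicator_one hNm]
    simp
  rw [← hint, ofReal_integral_eq_lintegral_ofReal hI123]
  · exact lintegral_mono fun z => potential_esNext_le hα hs hs1 hu hv hu1 hσ hm z
  · refine Eventually.of_forall fun z => ?_
    have h1 : S.indicator (1 : EuclideanSpace ℝ (Fin d) → ℝ) z ≤ 1 :=
      Set.indicator_le_self' (fun _ _ => zero_le_one) z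
    have h2 : N.indicator (1 : EuclideanSpace ℝ (Fin d) → ℝ) z ≤ 1 :=
      Set.indicator_le_self' (fun _ _ => zero_le_one) z
    have h3 : (v - u) * r * S.indicator 1 z ≤ (v - u) * r :=
      mul_le_of_le_one_right (mul_nonneg (by linarith) hr) h1
    have h4 : 0 ≤ A * (1 - N.indicator 1 z) := mul_nonneg hA (by linarith)
    have h5 : 0 ≤ u * r := mul_nonneg hu0 hr
    show (0 : ℝ) ≤ _
    linarith [norm_nonneg z]

/-- The choice of the weight `A` and of the rate `ρ`: below the level `R` the drift comes from the
probability `p` of losing the summand `A`, above `R` from the contraction factor `c`. -/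
lemma exists_drift_rate {c p R B v : ℝ} (hc0 : 0 < c) (hc1 : c < 1) (hp : 0 < p) (hR : 0 < R)
    (hB : 0 < B) (hv : 0 ≤ v) (hRB : 2 * B ≤ R * (1 - c)) :
    ∃ A ρ : ℝ, 0 < A ∧ ρ < 1 ∧
      (∀ r, 0 ≤ r → r ≤ R → v * r + B + A * (1 - p) ≤ ρ * (r + A)) ∧
      ∀ r, R ≤ r → c * r + B + A ≤ ρ * (r + A) := by
  obtain ⟨A, hA, hAp⟩ : ∃ A, 0 < A ∧ A * p = 2 * (v * R + B) :=
    ⟨2 * (v * R + B) / p, by positivity, div_mul_cancel₀ _ hp.ne'⟩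
  obtain ⟨q, hq, hqR⟩ : ∃ q, 0 < q ∧ q * (R + A) = (1 - c) / 2 * R := by
    have : 0 < 1 - c := by linarith
    exact ⟨(1 - c) / 2 * R / (R + A), by positivity, div_mul_cancel₀ _ (by positivity)⟩
  have hq1 : q ≤ 1 := by nlinarith
  obtain ⟨ρ, hρ, hρ1, hρ2⟩ : ∃ ρ, ρ < 1 ∧ 1 - p / 2 ≤ ρ ∧ 1 - q ≤ ρ :=
    ⟨max (1 - p / 2) (1 - q), max_lt (by linarith) (by linarith), le_max_left _ _,
      le_max_right _ _⟩
  refine ⟨A, ρ, hA, hρ, fun r hr hrR => ?_, fun r hrR => ?_⟩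
  · have h1 : v * r ≤ v * R := mul_le_mul_of_nonneg_left hrR hv
    have h2 : (1 - p / 2) * A ≤ ρ * A := mul_le_mul_of_nonneg_right hρ1 hA.le
    have h3 : 0 ≤ ρ * r := mul_nonneg (by linarith) hr
    linarith
  · have h1 : R * (1 - c) ≤ r * (1 - c) := mul_le_mul_of_nonneg_right hrR (by linarith)
    have h2 : (1 - q) * (r + A) ≤ ρ * (r + A) := mul_le_mul_of_nonneg_right hρ2 (by linarith)
    have h3 : q * (r + A) ≤ (1 - c) / 2 * r := by
      have h4 : q * (r + A) * (R + A) ≤ (1 - c) / 2 * r * (R + A) := by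
        have h5 : R * (r + A) ≤ r * (R + A) := by nlinarith
        calc q * (r + A) * (R + A) = (1 - c) / 2 * (R * (r + A)) := by
              rw [mul_right_comm, hqR]; ring
          _ ≤ (1 - c) / 2 * (r * (R + A)) := mul_le_mul_of_nonneg_left h5 (by linarith)
          _ = _ := by ring
      exact le_of_mul_le_mul_right h4 (by linarith)
    linarith

/-- The potential contracts in expectation by a uniform factor in every iteration. -/
lemma exists_potential_drift (ha : ∀ i, a i ≠ 0) {j : Fin d} (hj : a j < 0) {α : ℝ}
    (hα : 1 < α) :
    ∃ s A ρ : ℝ, 0 < A ∧ ρ < 1 ∧ ∀ (m : EuclideanSpace ℝ (Fin d)) (σ : ℝ), 0 < σ →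
      ∫⁻ z, potential a s A (esNext (quadSaddle a) α (m, σ) (m + σ • z))
          ∂stdGaussian (EuclideanSpace ℝ (Fin d)) ≤
        ENNReal.ofReal ρ * potential a s A (m, σ) := by
  obtain ⟨s, u, v, hs, hs1, hu, hv, hu0, hu1, hv1, huv⟩ := exists_rpow_contraction hα
  obtain ⟨K₀, hK₀, hsucc⟩ := exists_le_stdGaussian_success ha
  have hB0 : 0 < 1 + ∫ z, ‖z‖ ∂stdGaussian (EuclideanSpace ℝ (Fin d)) := by
    have : 0 ≤ ∫ z, ‖z‖ ∂stdGaussian (EuclideanSpace ℝ (Fin d)) :=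
      integral_nonneg fun _ => norm_nonneg _
    linarith
  obtain ⟨B, hB⟩ : ∃ B, 1 + ∫ z, ‖z‖ ∂stdGaussian (EuclideanSpace ℝ (Fin d)) = B := ⟨_, rfl⟩
  rw [hB] at hB0
  obtain ⟨c, hc⟩ : ∃ c, u / 4 + 3 * v / 4 = c := ⟨_, rfl⟩
  have hc0 : 0 < c := by linarith
  have hc1 : 0 < 1 - c := by linarith
  -- `K ^ s` has to be so large that the contraction outweighs the additive constant `B`
  obtain ⟨K, hKK₀, hKB⟩ : ∃ K, K₀ ≤ K ∧ (2 * B / (1 - c)) ^ s⁻¹ ≤ K :=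
    ⟨_, le_max_left _ _, le_max_right _ _⟩
  have hK0 : 0 < K := hK₀.trans_le hKK₀
  have hKs : 2 * B / (1 - c) ≤ K ^ s := by
    calc 2 * B / (1 - c) = ((2 * B / (1 - c)) ^ s⁻¹) ^ s := by
          rw [← Real.rpow_mul (by positivity), inv_mul_cancel₀ hs.ne', Real.rpow_one]
      _ ≤ K ^ s := by gcongr
  rw [div_le_iff₀ hc1] at hKs
  obtain ⟨p, hp, hneg⟩ := exists_le_stdGaussian_neg hj hK0
  obtain ⟨A, ρ, hA, hρ, hsmall, hlarge⟩ :=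
    exists_drift_rate hc0 (by linarith) hp (Real.rpow_pos_of_pos hK0 s) hB0
      (zero_le_one.trans hv1) hKs
  refine ⟨s, A, ρ, hA, hρ, fun m σ hσ => ?_⟩
  by_cases hm : 0 ≤ quadSaddle a m
  swap
  · have : ∀ z, potential a s A (esNext (quadSaddle a) α (m, σ) (m + σ • z)) = 0 := by
      intro z
      push Not at hm
      by_cases h : quadSaddle a (m + σ • z) ≤ quadSaddle a m
      · simp [potential, esNext, h, (h.trans_lt hm).not_ge]
      · simp [potential, esNext, h, hm.not_ge]
    simp [this]
  refine (lintegral_potential_esNext_le hα hs hs1 hu hv hu1 hv1 hA.le hσ hm).trans ?_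
  have hpot : potential a s A (m, σ) = ENNReal.ofReal ((‖m‖ / σ) ^ s + A) := by
    simp [potential, hm]
  have hr : 0 ≤ (‖m‖ / σ) ^ s := by positivity
  rw [hpot, ← ENNReal.ofReal_mul' (add_nonneg hr hA.le), hB]
  refine ENNReal.ofReal_le_ofReal ?_
  rcases le_total (‖m‖) (K * σ) with hmK | hmK
  · have h := hsmall _ hr (Real.rpow_le_rpow (by positivity) ((div_le_iff₀ hσ).2 hmK) hs.le)
    have h1 := mul_nonneg (mul_nonneg (sub_nonneg.2 (hu1.trans hv1)) hr)
      (measureReal_nonneg (μ := stdGaussian (EuclideanSpace ℝ (Fin d)))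
        (s := {z | quadSaddle a (m + σ • z) ≤ quadSaddle a m}))
    have h2 := mul_le_mul_of_nonneg_left (hneg m σ hσ hmK) hA.le
    linarith
  · have h := hlarge _ (Real.rpow_le_rpow hK0.le ((le_div_iff₀ hσ).2 hmK) hs.le)
    have h1 := mul_le_mul_of_nonneg_left
      (hsucc m σ hσ ((mul_le_mul_of_nonneg_right hKK₀ hσ.le).trans hmK))
      (mul_nonneg (sub_nonneg.2 (hu1.trans hv1)) hr)
    have h2 := mul_nonneg hA.le
      (measureReal_nonneg (μ := stdGaussian (EuclideanSpace ℝ (Fin d)))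
        (s := {z | quadSaddle a (m + σ • z) < 0}))
    rw [← hc] at h
    linarith
end

/-! ### The state sequence as a Markov chain -/

namespace IsOnePlusOneES

variable {d : ℕ} {f : EuclideanSpace ℝ (Fin d) → ℝ} {α : ℝ} {m₀ : EuclideanSpace ℝ (Fin d)}
  {σ₀ : ℝ} {Ω : Type*} [mΩ : MeasurableSpace Ω] {μ : Measure Ω} {ℱ : Filtration ℕ mΩ}
  {m : ℕ → Ω → EuclideanSpace ℝ (Fin d)} {σ : ℕ → Ω → ℝ} {x : ℕ → Ω → EuclideanSpace ℝ (Fin d)}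

lemma state_succ (h : IsOnePlusOneES f α m₀ σ₀ μ ℱ m σ x) (t : ℕ) (ω : Ω) :
    (m (t + 1) ω, σ (t + 1) ω) = esNext f α (m t ω, σ t ω) (x t ω) := by
  by_cases hf : f (x t ω) ≤ f (m t ω)
  · simp [esNext, hf, h.success t ω hf]
  · simp only [esNext, hf, h.failure t ω hf, if_false]

lemma measurable_state (h : IsOnePlusOneES f α m₀ σ₀ μ ℱ m σ x) (hf : Measurable f) (t : ℕ) :
    Measurable[ℱ t] fun ω => (m t ω, σ t ω) := by
  induction t with
  | zero =>
    simp only [h.mean_zero, h.step_zero]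
    exact measurable_const
  | succ t ih =>
    simp only [h.state_succ]
    exact (measurable_esNext hf α).comp
      ((ih.mono (ℱ.mono t.le_succ) le_rfl).prodMk (h.measurable_offspring t))

lemma step_pos (h : IsOnePlusOneES f α m₀ σ₀ μ ℱ m σ x) (hα : 0 < α) (hσ₀ : 0 < σ₀) (t : ℕ)
    (ω : Ω) : 0 < σ t ω := by
  induction t with
  | zero => rwa [h.step_zero]
  | succ t ih =>
    by_cases hf : f (x t ω) ≤ f (m t ω)
    · rw [(h.success t ω hf).2]; positivity
    · rw [(h.failure t ω hf).2]; positivity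

lemma antitone_objective (h : IsOnePlusOneES f α m₀ σ₀ μ ℱ m σ x) (ω : Ω) :
    Antitone fun t => f (m t ω) :=
  antitone_nat_of_succ_le fun t => by
    by_cases hf : f (x t ω) ≤ f (m t ω)
    · rw [(h.success t ω hf).1]; exact hf
    · rw [(h.failure t ω hf).1]

/-- The joint law of the state and its offspring: the offspring is `m + σ z` with `z` standard
Gaussian and independent of the state `(m, σ)`. -/
lemma map_state_offspring [IsProbabilityMeasure μ] (h : IsOnePlusOneES f α m₀ σ₀ μ ℱ m σ x)
    (hf : Measurable f) (hα : 0 < α) (hσ₀ : 0 < σ₀) (t : ℕ) :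
    μ.map (fun ω => ((m t ω, σ t ω), x t ω)) =
      ((μ.map fun ω => (m t ω, σ t ω)).prod (stdGaussian (EuclideanSpace ℝ (Fin d)))).map
        fun q => (q.1, q.1.1 + q.1.2 • q.2) := by
  set γ := stdGaussian (EuclideanSpace ℝ (Fin d))
  have hst := h.measurable_state hf t
  have hst' : Measurable fun ω => (m t ω, σ t ω) := hst.mono (ℱ.le t) le_rfl
  have hx : Measurable (x t) := (h.measurable_offspring t).mono (ℱ.le _) le_rfl
  have hstep : Measurable fun q : (EuclideanSpace ℝ (Fin d) × ℝ) × EuclideanSpace ℝ (Fin d) =>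
      (q.1, q.1.1 + q.1.2 • q.2) := by fun_prop
  have := Measure.isProbabilityMeasure_map (μ := μ) hst'.aemeasurable
  have := Measure.isProbabilityMeasure_map (μ := μ) (hst'.prodMk hx).aemeasurable
  refine Measure.ext_prod fun {S A} hS hA => ?_
  have hpre : MeasurableSet[ℱ t] ((fun ω => (m t ω, σ t ω)) ⁻¹' S) := hst hS
  have hpre' : MeasurableSet ((fun ω => (m t ω, σ t ω)) ⁻¹' S) := ℱ.le t _ hpre
  set D := {q : (EuclideanSpace ℝ (Fin d) × ℝ) × EuclideanSpace ℝ (Fin d) |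
    q.1.1 + q.1.2 • q.2 ∈ A} with hD
  have hDm : MeasurableSet D :=
    (show Measurable fun q : (EuclideanSpace ℝ (Fin d) × ℝ) × EuclideanSpace ℝ (Fin d) =>
      q.1.1 + q.1.2 • q.2 by fun_prop) hA
  have hk : Measurable fun p => γ (Prod.mk p ⁻¹' D) := measurable_measure_prodMk_left hDm
  have hrhs : (((μ.map fun ω => (m t ω, σ t ω)).prod γ).map
      fun q => (q.1, q.1.1 + q.1.2 • q.2)) (S ×ˢ A) =
      ∫⁻ ω in (fun ω => (m t ω, σ t ω)) ⁻¹' S, γ (Prod.mk (m t ω, σ t ω) ⁻¹' D) ∂μ := by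
    rw [Measure.map_apply hstep (hS.prod hA), Measure.prod_apply (hstep (hS.prod hA)),
      ← setLIntegral_map hS hk hst', ← lintegral_indicator hS]
    refine lintegral_congr fun p => ?_
    by_cases hp : p ∈ S
    · rw [Set.indicator_of_mem hp]
      congr 1
      ext z
      simp [hD, hp]
    · rw [Set.indicator_of_notMem hp]
      convert measure_empty (μ := γ)
      ext z
      simp [hp]
  have hcond : ∫ ω in (fun ω => (m t ω, σ t ω)) ⁻¹' S, γ.real (Prod.mk (m t ω, σ t ω) ⁻¹' D) ∂μ =
      μ.real ((fun ω => (m t ω, σ t ω)) ⁻¹' S ∩ x t ⁻¹' A) := by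
    have h1 := setIntegral_condExp (μ := μ) (ℱ.le t)
      ((integrable_const (1 : ℝ)).indicator (hx hA)) hpre
    have h2 : ∀ᵐ ω ∂μ, (μ⟦x t ⁻¹' A | ℱ t⟧) ω = γ.real (Prod.mk (m t ω, σ t ω) ⁻¹' D) := by
      filter_upwards [h.sample t A hA] with ω hω
      rw [hω, multivariateGaussian_sq_smul_one _ (h.step_pos hα hσ₀ t ω).le,
        map_measureReal_apply (by fun_prop) hA]
      rfl
    rw [← setIntegral_congr_ae hpre' (h2.mono fun ω hω _ => hω), h1,
      setIntegral_indicator (hx hA)]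
    simp
  rw [hrhs, Measure.map_apply (hst'.prodMk hx) (hS.prod hA)]
  rw [← ofReal_measureReal (measure_ne_top _ _),
    show (fun ω => ((m t ω, σ t ω), x t ω)) ⁻¹' S ×ˢ A =
      (fun ω => (m t ω, σ t ω)) ⁻¹' S ∩ x t ⁻¹' A by ext; simp, ← hcond,
    ofReal_integral_eq_lintegral_ofReal]
  · exact lintegral_congr fun ω => ofReal_measureReal (measure_ne_top _ _)
  · refine Integrable.of_bound (C := 1) ?_ (Eventually.of_forall fun ω => ?_)
    · exact (hk.comp hst').ennreal_toReal.aestronglyMeasurable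
    · rw [Real.norm_of_nonneg measureReal_nonneg]
      exact measureReal_le_one
  · exact Eventually.of_forall fun ω => measureReal_nonneg

lemma lintegral_state_succ [IsProbabilityMeasure μ] (h : IsOnePlusOneES f α m₀ σ₀ μ ℱ m σ x)
    (hf : Measurable f) (hα : 0 < α) (hσ₀ : 0 < σ₀) (t : ℕ)
    {V : EuclideanSpace ℝ (Fin d) × ℝ → ENNReal} (hV : Measurable V) :
    ∫⁻ ω, V (m (t + 1) ω, σ (t + 1) ω) ∂μ =
      ∫⁻ ω, ∫⁻ z, V (esNext f α (m t ω, σ t ω) (m t ω + σ t ω • z))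
        ∂stdGaussian (EuclideanSpace ℝ (Fin d)) ∂μ := by
  have hst' : Measurable fun ω => (m t ω, σ t ω) :=
    (h.measurable_state hf t).mono (ℱ.le t) le_rfl
  have hx : Measurable (x t) := (h.measurable_offspring t).mono (ℱ.le _) le_rfl
  have hstep : Measurable fun q : (EuclideanSpace ℝ (Fin d) × ℝ) × EuclideanSpace ℝ (Fin d) =>
      (q.1, q.1.1 + q.1.2 • q.2) := by fun_prop
  have hG : Measurable fun q : (EuclideanSpace ℝ (Fin d) × ℝ) × EuclideanSpace ℝ (Fin d) =>
      V (esNext f α q.1 q.2) := hV.comp (measurable_esNext hf α)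
  have hGstep : Measurable fun q : (EuclideanSpace ℝ (Fin d) × ℝ) × EuclideanSpace ℝ (Fin d) =>
      V (esNext f α q.1 (q.1.1 + q.1.2 • q.2)) := hG.comp hstep
  simp only [h.state_succ]
  rw [← lintegral_map (f := fun q => V (esNext f α q.1 q.2)) hG (hst'.prodMk hx),
    h.map_state_offspring hf hα hσ₀, lintegral_map hG hstep,
    lintegral_prod _ hGstep.aemeasurable,
    lintegral_map hGstep.lintegral_prod_right' hst']

/-- A nonnegative potential that is bounded below by `A > 0` wherever the objective is nonnegative,
and contracts geometrically in expectation, forces the objective to become negative almost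
surely. -/
lemma ae_exists_neg [IsProbabilityMeasure μ] (h : IsOnePlusOneES f α m₀ σ₀ μ ℱ m σ x)
    (hf : Measurable f) (hα : 0 < α) (hσ₀ : 0 < σ₀)
    {V : EuclideanSpace ℝ (Fin d) × ℝ → ENNReal} (hV : Measurable V) {A ρ : ENNReal}
    (hA : A ≠ 0) (hρ : ρ < 1) (hV₀ : V (m₀, σ₀) ≠ ⊤) (hAV : ∀ m σ, 0 < σ → 0 ≤ f m → A ≤ V (m, σ))
    (hdrift : ∀ m σ, 0 < σ → ∫⁻ z, V (esNext f α (m, σ) (m + σ • z))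
      ∂stdGaussian (EuclideanSpace ℝ (Fin d)) ≤ ρ * V (m, σ)) :
    ∀ᵐ ω ∂μ, ∃ t, f (m t ω) < 0 := by
  have hE : ∀ t, ∫⁻ ω, V (m t ω, σ t ω) ∂μ ≤ ρ ^ t * V (m₀, σ₀) := by
    intro t
    induction t with
    | zero => simp [h.mean_zero, h.step_zero]
    | succ t ih =>
      have hst' : Measurable fun ω => (m t ω, σ t ω) :=
        (h.measurable_state hf t).mono (ℱ.le t) le_rfl
      rw [h.lintegral_state_succ hf hα hσ₀ t hV]
      calc _ ≤ ∫⁻ ω, ρ * V (m t ω, σ t ω) ∂μ :=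
            lintegral_mono fun ω => hdrift _ _ (h.step_pos hα hσ₀ t ω)
        _ = ρ * ∫⁻ ω, V (m t ω, σ t ω) ∂μ := lintegral_const_mul _ (hV.comp hst')
        _ ≤ ρ * (ρ ^ t * V (m₀, σ₀)) := by gcongr
        _ = ρ ^ (t + 1) * V (m₀, σ₀) := by rw [pow_succ', mul_assoc]
  rw [ae_iff]
  push Not
  have hbound : ∀ t, A * μ {ω | ∀ t, 0 ≤ f (m t ω)} ≤ ρ ^ t * V (m₀, σ₀) := by
    intro t
    have hst' : Measurable fun ω => (m t ω, σ t ω) :=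
      (h.measurable_state hf t).mono (ℱ.le t) le_rfl
    refine le_trans ?_ ((mul_meas_ge_le_lintegral (hV.comp hst') A).trans (hE t))
    exact mul_le_mul' le_rfl <| measure_mono fun ω hω => hAV _ _ (h.step_pos hα hσ₀ t ω) (hω t)
  have hlim : Tendsto (fun t => ρ ^ t * V (m₀, σ₀)) atTop (𝓝 0) := by
    simpa using ENNReal.Tendsto.mul_const (ENNReal.tendsto_pow_atTop_nhds_zero_of_lt_one hρ)
      (Or.inr hV₀)
  have hzero := le_antisymm (ge_of_tendsto' hlim hbound) zero_le
  exact (mul_eq_zero.1 hzero).resolve_left hA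

end IsOnePlusOneES

theorem theorem1 {d b : ℕ} (hb : 1 ≤ b) (hbd : b < d) (a : Fin d → ℝ)
    (ha_neg : ∀ i : Fin d, (i : ℕ) < b → a i < 0)
    (ha_pos : ∀ i : Fin d, b ≤ (i : ℕ) → 0 < a i)
    (α : ℝ) (hα : 1 < α) (m₀ : EuclideanSpace ℝ (Fin d)) (σ₀ : ℝ) (hσ₀ : 0 < σ₀)
    {Ω : Type*} [MeasurableSpace Ω] (μ : Measure Ω) [IsProbabilityMeasure μ]
    (ℱ : Filtration ℕ ‹MeasurableSpace Ω›)
    (m : ℕ → Ω → EuclideanSpace ℝ (Fin d)) (σ : ℕ → Ω → ℝ)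
    (x : ℕ → Ω → EuclideanSpace ℝ (Fin d))
    (hES : IsOnePlusOneES (quadSaddle a) α m₀ σ₀ μ ℱ m σ x) :
    (∀ᵐ ω ∂μ, ∃ T : ℕ, ∀ t : ℕ, T ≤ t → quadSaddle a (m t ω) < 0) ∧
      ∀ᵐ ω ∂μ, ¬ MapClusterPt (0 : EuclideanSpace ℝ (Fin d)) atTop (fun t => m t ω) := by
  have ha : ∀ i, a i ≠ 0 := fun i => by
    rcases lt_or_ge (i : ℕ) b with hi | hi
    · exact (ha_neg i hi).ne
    · exact (ha_pos i hi).ne'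
  obtain ⟨s, A, ρ, hA, hρ, hdrift⟩ :=
    exists_potential_drift ha (j := ⟨0, by omega⟩) (ha_neg _ hb) hα
  have hneg : ∀ᵐ ω ∂μ, ∃ t, quadSaddle a (m t ω) < 0 := by
    refine hES.ae_exists_neg (continuous_quadSaddle a).measurable (by linarith) hσ₀
      (measurable_potential a s A) (A := ENNReal.ofReal A) (ρ := ENNReal.ofReal ρ)
      (ENNReal.ofReal_pos.2 hA).ne' (by simpa using hρ) ?_ ?_ hdrift
    · unfold potential
      split_ifs <;> simp
    · intro m σ hσ hm
      rw [potential, if_pos hm]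
      exact ENNReal.ofReal_le_ofReal (le_add_of_nonneg_left (by positivity))
  constructor
  · filter_upwards [hneg] with ω ⟨T, hT⟩
    exact ⟨T, fun t ht => (hES.antitone_objective ω ht).trans_lt hT⟩
  · filter_upwards [hneg] with ω ⟨T, hT⟩ hcl
    have hcl' := hcl.continuousAt_comp (continuous_quadSaddle a).continuousAt
    have hmem : quadSaddle a 0 ∈ Set.Iic (quadSaddle a (m T ω)) :=
      isClosed_Iic.mem_of_mapClusterPt hcl'
        (eventually_atTop.2 ⟨T, fun t ht => hES.antitone_objective ω ht⟩)
    have h0 : quadSaddle a 0 = 0 := by simp [quadSaddle]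
    rw [Set.mem_Iic, h0] at hmem
    exact hmem.not_gt hT
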